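/- Let $n\ge 1$. For $B\in GL_n(\mathbb R)$ let $L(B)\subset\mathbb R^n$ be the lattice generated by the columns of $B$. For a full-rank lattice $L$ put $\min L:=\inf\{|l|^2 : 0\ne l\in L\}$, let $$\Delta(L):=\frac{\mathrm{vol}(B(1))\,(\min L)^{n/2}}{2^n\,\mathrm{vol}(\mathbb R^n/L)}$$ be its packing density ($B(1)$ being the Euclidean unit ball of $\mathbb R^n$), and define $$\Delta'(L(B)):=\inf_{D\in GL_n(\mathbb R)\text{ diagonal}}\Delta(L(DB)),\qquad \Delta'_n:=\sup_{B\in GL_n(\mathbb R)}\Delta'(L(B)),$$ $$\lambda'(B):=\inf_{D\text{ diagonal},\ \det D=\pm1}\min L(DB),\qquad \lambda'_n:=\sup_{\det B=\pm1}\lambda'(B),$$ $$\lambda(B):=\inf_{0\ne x\in\mathbb Z^n}\Big|\prod_{i=1}^n(b_{i1}x_1+\cdots+b_{in}x_n)\Big|,\qquad \lambda_n:=\sup_{\det B=\pm1}\lambda(B).$$ (1) For every $B\in GL_n(\mathbb R)$ with $\lambda(B)\ne0$, $\lambda'(B)=n\,\lambda(B)^{2/n}$. (2) The suprema $\lambda_n$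 and $\lambda'_n$ are finite. If $K$ is a totally real number field of degree $n$ with discriminant $d_K$, then $\lambda_n\ge d_K^{-1/2}$. Furthermore, for each $n$ the supremum $\Delta'_n$ is attained by some $B_n\in GL_n(\mathbb R)$, and $$\Delta'_n=\frac{(\pi\lambda'_n/4)^{n/2}}{\Gamma(n/2+1)}=\frac{(\pi n/4)^{n/2}\lambda_n}{\Gamma(n/2+1)}\ge\frac{(\pi n/4)^{n/2}d_K^{-1/2}}{\Gamma(n/2+1)},$$ the last inequality for every totally real number field $K$ of degree $n$. -/

import Mathlib

open scoped MatrixGroups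

universe u

/-- `L(B)`: the lattice in `ℝⁿ` generated over `ℤ` by the column vectors of `B`. -/
def columnLattice {n : ℕ} (B : GL (Fin n) ℝ) : Submodule ℤ (EuclideanSpace ℝ (Fin n)) :=
  Submodule.span ℤ (Set.range fun j : Fin n =>
    (WithLp.toLp 2 (fun i : Fin n => B.1 i j) : EuclideanSpace ℝ (Fin n)))

/-- `min L`: the least *squared* Euclidean length of a nonzero vector of `L`. -/
noncomputable def latticeMin {n : ℕ} (L : Submodule ℤ (EuclideanSpace ℝ (Fin n))) : ℝ :=
  sInf {r : ℝ | ∃ l ∈ L, l ≠ 0 ∧ r = ‖l‖ ^ 2}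

/-- The packing density `Δ(L) = vol(B(1)) (min L)^(n/2) / (2ⁿ vol(ℝⁿ/L))`
of a full-rank lattice `L`. -/
noncomputable def packingDensity {n : ℕ} (L : Submodule ℤ (EuclideanSpace ℝ (Fin n))) : ℝ :=
  (MeasureTheory.volume (Metric.ball (0 : EuclideanSpace ℝ (Fin n)) 1)).toReal
      * latticeMin L ^ ((n : ℝ) / 2)
    / (2 ^ n * ZLattice.covolume L)

/-- The invertible diagonal matrices. -/
def diagGL (n : ℕ) : Set (GL (Fin n) ℝ) := {D | D.1.IsDiag}

/-- The matrices of determinant `1` or `-1`. -/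
def detPmOne (n : ℕ) : Set (GL (Fin n) ℝ) := {B | B.1.det = 1 ∨ B.1.det = -1}

/-- `Δ'(L(B))`: the infimum of `Δ(L(DB))` over all invertible diagonal `D`. -/
noncomputable def densityInf {n : ℕ} (B : GL (Fin n) ℝ) : ℝ :=
  sInf ((fun D => packingDensity (columnLattice (D * B))) '' diagGL n)

/-- `Δ'_n`: the supremum of `Δ'(L(B))` over all `B ∈ GL_n(ℝ)`. -/
noncomputable def densitySup (n : ℕ) : ℝ :=
  sSup (Set.range fun B : GL (Fin n) ℝ => densityInf B)

/-- `λ'(B)`: the infimum of `min L(DB)` over all diagonal `D` with `det D = ±1`. -/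
noncomputable def lambdaPrime {n : ℕ} (B : GL (Fin n) ℝ) : ℝ :=
  sInf ((fun D => latticeMin (columnLattice (D * B))) '' (diagGL n ∩ detPmOne n))

/-- `λ'_n`: the supremum of `λ'(B)` over all `B` with `det B = ±1`. -/
noncomputable def lambdaPrimeSup (n : ℕ) : ℝ :=
  sSup (lambdaPrime '' detPmOne n)

/-- `λ(B)`: the infimum over nonzero integer vectors `x` of the absolute value of the product
of the linear forms `b_{i1} x_1 + ⋯ + b_{in} x_n`. -/
noncomputable def lambdaForms {n : ℕ} (B : GL (Fin n) ℝ) : ℝ :=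
  sInf ((fun x : Fin n → ℤ => |∏ i, ∑ j, B.1 i j * (x j : ℝ)|) '' {x | x ≠ 0})

/-- `λ_n`: the supremum of `λ(B)` over all `B` with `det B = ±1`. -/
noncomputable def lambdaFormsSup (n : ℕ) : ℝ :=
  sSup (lambdaForms '' detPmOne n)

/-! Everything reduces to `λ`. For `y = Bx`, AM-GM gives `n |∏ yᵢ|^(2/n) ≤ ∑ yᵢ²`. Diagonal scalings
of determinant `±1` preserve `|∏ yᵢ|`, and they bring `∑ yᵢ²` arbitrarily close to the left side by
equalising the coordinates. Taking infima over `x` and over the scalings yields `lambdaPrime_eq`.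
The density is invariant under homothety, so `densityInf` is an increasing function of `λ'`, and one
maximiser of `λ` maximises all three quantities.

The substance is the existence of that maximiser, a form of Mahler's compactness theorem. If `λ(B) ≥
c > 0`, nonzero vectors of `Bℤⁿ` have sup norm at least `c^(1/n)`. Minkowski's theorem then gives
`n` independent lattice vectors of bounded length (`exists_intMatrix_norm_le`). They span a
sublattice of bounded index, and finitely many residue classes of integer matrices suffice to turn
them into a bounded basis (`exists_isUnit_mul_bounded`). So the competitors can be taken in a
compact set, on which `λ`, an infimum of continuous functions, attains its maximum.

For a totally real field, the real embeddings of an integral basis give a matrix with `det² = d_K`.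
Its products of forms are norms of nonzero integers, hence at least `1` in absolute value. -/

open MeasureTheory Matrix

/-! ### Lattices in integer coordinates, covolume, Minkowski's theorem -/

/-- The image `Mx` of an integer vector `x`. -/
def intMulVec {n : ℕ} (M : Matrix (Fin n) (Fin n) ℝ) (x : Fin n → ℤ) : Fin n → ℝ :=
  M.mulVec fun j => (x j : ℝ)

lemma intMulVec_apply {n : ℕ} (M : Matrix (Fin n) (Fin n) ℝ) (x : Fin n → ℤ) (i : Fin n) :
    intMulVec M x i = ∑ j, M i j * (x j : ℝ) := rfl

lemma intMulVec_zero {n : ℕ} (M : Matrix (Fin n) (Fin n) ℝ) : intMulVec M 0 = 0 := by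
  ext i; simp [intMulVec_apply]

lemma intMulVec_injective {n : ℕ} {M : Matrix (Fin n) (Fin n) ℝ} (hM : M.det ≠ 0) :
    Function.Injective (intMulVec M) := by
  intro x y hxy
  have h := Matrix.mulVec_injective_of_isUnit
    ((Matrix.isUnit_iff_isUnit_det M).2 (isUnit_iff_ne_zero.2 hM)) hxy
  ext j
  exact_mod_cast congrFun h j

lemma intMulVec_ne_zero {n : ℕ} {M : Matrix (Fin n) (Fin n) ℝ} (hM : M.det ≠ 0)
    {x : Fin n → ℤ} (hx : x ≠ 0) : intMulVec M x ≠ 0 := fun h =>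
  hx (intMulVec_injective hM (h.trans (intMulVec_zero M).symm))

lemma intMulVec_mul {n : ℕ} (M N : Matrix (Fin n) (Fin n) ℝ) (x : Fin n → ℤ) :
    intMulVec (M * N) x = M.mulVec (intMulVec N x) := by
  simp [intMulVec, Matrix.mulVec_mulVec]

lemma intMulVec_mul_map {n : ℕ} (M : Matrix (Fin n) (Fin n) ℝ) (U : Matrix (Fin n) (Fin n) ℤ)
    (x : Fin n → ℤ) : intMulVec (M * U.map (Int.cast : ℤ → ℝ)) x = intMulVec M (U.mulVec x) := by
  rw [intMulVec_mul]
  simp only [intMulVec]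
  congr 1
  ext i
  simp [Matrix.mulVec, dotProduct]

lemma GL_det_ne_zero {n : ℕ} (B : GL (Fin n) ℝ) : B.1.det ≠ 0 :=
  ((Matrix.isUnit_iff_isUnit_det _).1 B.isUnit).ne_zero

lemma exists_intVec_ne_zero {n : ℕ} (hn : 1 ≤ n) : ∃ x : Fin n → ℤ, x ≠ 0 :=
  ⟨fun _ => 1, fun h => by simpa using congrFun h ⟨0, hn⟩⟩

/-- The columns of an invertible matrix as a basis of Euclidean space. -/
noncomputable def columnBasis {n : ℕ} (B : GL (Fin n) ℝ) :
    Module.Basis (Fin n) ℝ (EuclideanSpace ℝ (Fin n)) :=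
  (Pi.basisFun ℝ (Fin n)).map
    ((Matrix.toLinearEquiv' B.1 ⟨B.inv, B.inv_val, B.val_inv⟩).trans
      (WithLp.linearEquiv 2 ℝ (Fin n → ℝ)).symm)

lemma columnBasis_apply {n : ℕ} (B : GL (Fin n) ℝ) (j : Fin n) :
    columnBasis B j = WithLp.toLp 2 (fun i : Fin n => B.1 i j) := by
  ext i
  simp [columnBasis, Matrix.toLinearEquiv']

lemma columnLattice_eq {n : ℕ} (B : GL (Fin n) ℝ) :
    columnLattice B = Submodule.span ℤ (Set.range (columnBasis B)) := by
  simp only [columnLattice]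
  congr 2
  ext1 j
  exact (columnBasis_apply B j).symm

lemma mem_columnLattice {n : ℕ} (B : GL (Fin n) ℝ) (l : EuclideanSpace ℝ (Fin n)) :
    l ∈ columnLattice B ↔ ∃ x : Fin n → ℤ, l = WithLp.toLp 2 (intMulVec B.1 x) := by
  rw [columnLattice, Submodule.mem_span_range_iff_exists_fun]
  refine exists_congr fun x => ?_
  rw [eq_comm]
  have : ∑ i, x i • (WithLp.toLp 2 (fun k : Fin n => B.1 k i) : EuclideanSpace ℝ (Fin n))
      = WithLp.toLp 2 (intMulVec B.1 x) := by
    ext i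
    simp [intMulVec_apply, mul_comm]
  rw [this]

lemma latticeMin_columnLattice {n : ℕ} (B : GL (Fin n) ℝ) :
    latticeMin (columnLattice B)
      = sInf ((fun x : Fin n → ℤ => ∑ i, intMulVec B.1 x i ^ 2) '' {x | x ≠ 0}) := by
  unfold latticeMin
  congr 1
  ext r
  constructor
  · rintro ⟨l, hl, h0, rfl⟩
    obtain ⟨x, rfl⟩ := (mem_columnLattice B l).1 hl
    refine ⟨x, ?_, ?_⟩
    · rintro rfl
      exact h0 (by simp [intMulVec_zero])
    · simp [EuclideanSpace.real_norm_sq_eq]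
  · rintro ⟨x, hx, rfl⟩
    refine ⟨_, (mem_columnLattice B _).2 ⟨x, rfl⟩, ?_, ?_⟩
    · intro h
      exact intMulVec_ne_zero (GL_det_ne_zero B) hx (by simpa using h)
    · simp [EuclideanSpace.real_norm_sq_eq]

lemma covolume_columnLattice {n : ℕ} (B : GL (Fin n) ℝ) :
    ZLattice.covolume (columnLattice B) = |B.1.det| := by
  rw [columnLattice_eq]
  rw [ZLattice.covolume_eq_measure_fundamentalDomain _ _
    (ZSpan.isAddFundamentalDomain (columnBasis B) volume)]
  rw [ZSpan.measureReal_fundamentalDomain _ _ (EuclideanSpace.basisFun (Fin n) ℝ).toBasis,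
    measureReal_congr (ZSpan.fundamentalDomain_ae_parallelepiped _ volume), measureReal_def]
  have hdet : (EuclideanSpace.basisFun (Fin n) ℝ).toBasis.det (columnBasis B) = B.1.det := by
    rw [Module.Basis.det_apply]
    congr 1
    ext i j
    simp [Module.Basis.toMatrix_apply, columnBasis_apply]
  rw [hdet, OrthonormalBasis.coe_toBasis, OrthonormalBasis.volume_parallelepiped]
  simp

/-- Minkowski's theorem for the lattice `Mℤⁿ` and the supremum norm. -/
lemma exists_norm_intMulVec_lt_one {n : ℕ} {M : Matrix (Fin n) (Fin n) ℝ}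
    (hM0 : M.det ≠ 0) (hM : |M.det| < 1) :
    ∃ x : Fin n → ℤ, x ≠ 0 ∧ ‖intMulVec M x‖ < 1 := by
  have hfund := ZSpan.isAddFundamentalDomain' (Pi.basisFun ℝ (Fin n)) volume
  set s : Set (Fin n → ℝ) := (Matrix.toLin' M) ⁻¹' (Metric.ball 0 1)
  have hsymm : ∀ x ∈ s, -x ∈ s := fun x hx => by
    simpa [s, Matrix.mulVec_neg] using hx
  have hconv : Convex ℝ s := (convex_ball (0 : Fin n → ℝ) 1).linear_preimage _
  -- The preimage of the open unit cube has volume `2^n / |det M|`, which exceeds `2^n`.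
  have hvol : volume (ZSpan.fundamentalDomain (Pi.basisFun ℝ (Fin n)))
      * 2 ^ Module.finrank ℝ (Fin n → ℝ) < volume s := by
    rw [ZSpan.fundamentalDomain_pi_basisFun, Measure.addHaar_preimage_linearMap]
    · simp [Real.volume_pi_ball]
      have h1 : volume (Set.univ.pi fun _ : Fin n => Set.Ico (0 : ℝ) 1) = 1 := by
        simp [volume_pi, Measure.pi_pi]
      rw [h1]
      refine (ENNReal.mul_lt_mul_iff_left (c := 2 ^ n) (by simp) (by simp)).2 ?_
      rw [ENNReal.one_lt_ofReal]
      exact (one_lt_inv₀ (abs_pos.2 hM0)).2 hM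
    · simpa using hM0
  have : Countable (Submodule.span ℤ (Set.range (Pi.basisFun ℝ (Fin n)))).toAddSubgroup := by
    change Countable (Submodule.span ℤ (Set.range (Pi.basisFun ℝ (Fin n))))
    infer_instance
  obtain ⟨⟨v, hv⟩, hv0, hvs⟩ :=
    exists_ne_zero_mem_lattice_of_measure_mul_two_pow_lt_measure hfund hsymm hconv hvol
  obtain ⟨x, hxv⟩ := (Submodule.mem_span_range_iff_exists_fun ℤ).1 hv
  obtain rfl : (fun j => (x j : ℝ)) = v := by
    rw [← hxv]
    ext j
    simp [Pi.single_apply]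
  refine ⟨x, ?_, ?_⟩
  · rintro rfl
    exact hv0 (by ext; simp)
  · simpa [s, intMulVec] using hvs

/-! ### The identity between `λ'` and `λ` -/

/-- A pointwise form of `λ'(B) = n λ(B)^{2/n}`, `≥`. -/
lemma card_mul_abs_prod_rpow_le_sum_sq {n : ℕ} (hn : 1 ≤ n) (y : Fin n → ℝ) :
    n * |∏ i, y i| ^ (2 / (n : ℝ)) ≤ ∑ i, y i ^ 2 := by
  have hn0 : (0 : ℝ) < n := by exact_mod_cast hn
  have h := Real.geom_mean_le_arith_mean Finset.univ (fun _ : Fin n => (1 : ℝ))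
    (fun i => y i ^ 2) (by simp) (by simpa using hn0) (fun i _ => sq_nonneg _)
  simp only [Real.rpow_one, one_mul, Finset.sum_const, Finset.card_univ, Fintype.card_fin,
    nsmul_eq_mul, mul_one] at h
  rw [le_div_iff₀ hn0] at h
  have h2 : |∏ i, y i| ^ (2 / (n : ℝ)) = (∏ i, y i ^ 2) ^ (n : ℝ)⁻¹ := by
    rw [Finset.prod_pow, ← sq_abs, ← Real.rpow_natCast, ← Real.rpow_mul (abs_nonneg _)]
    norm_num [div_eq_mul_inv]
  rw [h2, mul_comm]
  exact h

/-- Rescaling the coordinates with determinant one brings the squared length of `y` down to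
`n (∏ (yᵢ² + ε))^{1/n}`. -/
lemma exists_prod_eq_one_sum_sq_le {n : ℕ} (hn : 1 ≤ n) (y : Fin n → ℝ) {ε : ℝ} (hε : 0 < ε) :
    ∃ d : Fin n → ℝ, ∏ i, d i = 1 ∧
      ∑ i, (d i * y i) ^ 2 ≤ n * (∏ i, (y i ^ 2 + ε)) ^ (n : ℝ)⁻¹ := by
  have hz : ∀ i, 0 < y i ^ 2 + ε := fun i => by positivity
  have hP : 0 < ∏ i, (y i ^ 2 + ε) := Finset.prod_pos fun i _ => hz i
  set t := (∏ i, (y i ^ 2 + ε)) ^ (n : ℝ)⁻¹ with ht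
  have ht0 : 0 < t := Real.rpow_pos_of_pos hP _
  have htn : t ^ n = ∏ i, (y i ^ 2 + ε) :=
    Real.rpow_inv_natCast_pow hP.le (by omega)
  -- This choice makes every `dᵢ² (yᵢ² + ε)` equal to `t`, the geometric mean; `ε` keeps `dᵢ` finite
  -- where `yᵢ = 0`.
  refine ⟨fun i => √(t / (y i ^ 2 + ε)), ?_, ?_⟩
  · rw [← Real.sqrt_prod _ fun i _ => (div_pos ht0 (hz i)).le, Finset.prod_div_distrib]
    simp [htn, div_self hP.ne']
  · calc ∑ i, (√(t / (y i ^ 2 + ε)) * y i) ^ 2 ≤ ∑ _i : Fin n, t := by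
          refine Finset.sum_le_sum fun i _ => ?_
          rw [mul_pow, Real.sq_sqrt (div_pos ht0 (hz i)).le, div_mul_eq_mul_div,
            div_le_iff₀ (hz i)]
          nlinarith
      _ = n * t := by simp

/-- The diagonal matrix with nonzero diagonal `d`. -/
noncomputable def diagUnit {n : ℕ} (d : Fin n → ℝ) (hd : ∏ i, d i ≠ 0) : GL (Fin n) ℝ :=
  Matrix.GeneralLinearGroup.mkOfDetNeZero (Matrix.diagonal d) (by rwa [Matrix.det_diagonal])

lemma diagUnit_val {n : ℕ} (d : Fin n → ℝ) (hd : ∏ i, d i ≠ 0) :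
    (diagUnit d hd).1 = Matrix.diagonal d := rfl

lemma diagUnit_mem {n : ℕ} (d : Fin n → ℝ) (hd : ∏ i, d i ≠ 0) : diagUnit d hd ∈ diagGL n := by
  change (Matrix.diagonal d).IsDiag
  exact Matrix.isDiag_diagonal d

lemma eq_diagonal_of_mem_diagGL {n : ℕ} {D : GL (Fin n) ℝ} (hD : D ∈ diagGL n) :
    D.1 = Matrix.diagonal fun i => D.1 i i :=
  (Matrix.IsDiag.diagonal_diag hD).symm

lemma intMulVec_diagonal_mul {n : ℕ} (d : Fin n → ℝ) (M : Matrix (Fin n) (Fin n) ℝ)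
    (x : Fin n → ℤ) (i : Fin n) :
    intMulVec (Matrix.diagonal d * M) x i = d i * intMulVec M x i := by
  rw [intMulVec_mul, Matrix.mulVec_diagonal]

lemma mem_detPmOne_iff {n : ℕ} (B : GL (Fin n) ℝ) : B ∈ detPmOne n ↔ |B.1.det| = 1 := by
  rw [abs_eq zero_le_one]; rfl

lemma one_mem_detPmOne (n : ℕ) : (1 : GL (Fin n) ℝ) ∈ detPmOne n := by
  simp [mem_detPmOne_iff]

lemma one_mem_diagGL (n : ℕ) : (1 : GL (Fin n) ℝ) ∈ diagGL n := by
  simp [diagGL]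

lemma latticeMin_nonneg {n : ℕ} (L : Submodule ℤ (EuclideanSpace ℝ (Fin n))) :
    0 ≤ latticeMin L :=
  Real.sInf_nonneg (by rintro _ ⟨l, _, _, rfl⟩; positivity)

lemma lambdaPrime_nonneg {n : ℕ} (B : GL (Fin n) ℝ) : 0 ≤ lambdaPrime B :=
  Real.sInf_nonneg (by rintro _ ⟨D, _, rfl⟩; exact latticeMin_nonneg _)

lemma lambdaForms_nonneg {n : ℕ} (B : GL (Fin n) ℝ) : 0 ≤ lambdaForms B :=
  Real.sInf_nonneg (by rintro _ ⟨D, _, rfl⟩; exact abs_nonneg _)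

lemma lambdaForms_eq {n : ℕ} (B : GL (Fin n) ℝ) :
    lambdaForms B = sInf ((fun x : Fin n → ℤ => |∏ i, intMulVec B.1 x i|) '' {x | x ≠ 0}) := rfl

lemma lambdaForms_le {n : ℕ} (B : GL (Fin n) ℝ) {x : Fin n → ℤ} (hx : x ≠ 0) :
    lambdaForms B ≤ |∏ i, intMulVec B.1 x i| :=
  csInf_le ⟨0, by rintro _ ⟨D, _, rfl⟩; exact abs_nonneg _⟩ ⟨x, hx, rfl⟩

lemma latticeMin_le {n : ℕ} (B : GL (Fin n) ℝ) {x : Fin n → ℤ} (hx : x ≠ 0) :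
    latticeMin (columnLattice B) ≤ ∑ i, intMulVec B.1 x i ^ 2 := by
  rw [latticeMin_columnLattice]
  exact csInf_le ⟨0, by rintro _ ⟨D, _, rfl⟩; positivity⟩ ⟨x, hx, rfl⟩

lemma lambdaPrime_le {n : ℕ} (B : GL (Fin n) ℝ) {D : GL (Fin n) ℝ} (hD : D ∈ diagGL n)
    (hD1 : D ∈ detPmOne n) : lambdaPrime B ≤ latticeMin (columnLattice (D * B)) :=
  csInf_le ⟨0, by rintro _ ⟨D, _, rfl⟩; exact latticeMin_nonneg _⟩ ⟨D, ⟨hD, hD1⟩, rfl⟩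

/-- Each `ε > 0` supplies an admissible scaling, and the bound is continuous in `ε`. Letting `ε → 0`
also covers vectors with a vanishing coordinate, for which no single scaling need attain the bound.
-/
lemma lambdaPrime_le_card_mul_abs_prod {n : ℕ} (hn : 1 ≤ n) (B : GL (Fin n) ℝ)
    {x : Fin n → ℤ} (hx : x ≠ 0) :
    lambdaPrime B ≤ n * |∏ i, intMulVec B.1 x i| ^ (2 / (n : ℝ)) := by
  set y := intMulVec B.1 x with hy
  have hn0 : (0 : ℝ) < n := by exact_mod_cast hn
  have h1 : ∀ ε > 0, lambdaPrime B ≤ n * (∏ i, (y i ^ 2 + ε)) ^ (n : ℝ)⁻¹ := by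
    intro ε hε
    obtain ⟨d, hd, hsum⟩ := exists_prod_eq_one_sum_sq_le hn y hε
    have hd0 : ∏ i, d i ≠ 0 := by simp [hd]
    refine (lambdaPrime_le B (diagUnit_mem d hd0) ?_).trans ((latticeMin_le _ hx).trans ?_)
    · rw [mem_detPmOne_iff, diagUnit_val, Matrix.det_diagonal, hd, abs_one]
    · rw [Units.val_mul, diagUnit_val]
      simpa only [intMulVec_diagonal_mul] using hsum
  have hcont : Continuous fun ε : ℝ => n * (∏ i, (y i ^ 2 + ε)) ^ (n : ℝ)⁻¹ := by
    refine continuous_const.mul (Continuous.rpow_const (by fun_prop) fun _ => Or.inr (by positivity))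
  have hlim := (hcont.tendsto 0).mono_left (nhdsWithin_le_nhds (s := Set.Ioi (0 : ℝ)))
  have h2 := ge_of_tendsto hlim (eventually_nhdsWithin_of_forall h1)
  have h3 : |∏ i, y i| ^ (2 / (n : ℝ)) = (∏ i, (y i ^ 2 + 0)) ^ (n : ℝ)⁻¹ := by
    simp only [add_zero]
    rw [Finset.prod_pow, ← sq_abs, ← Real.rpow_natCast, ← Real.rpow_mul (abs_nonneg _)]
    norm_num [div_eq_mul_inv]
  rw [h3]
  exact h2

/-- A diagonal matrix of determinant `±1` changes the product of the forms at most by sign, so AM-GM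
gives the same lower bound for every `D`. -/
lemma le_lambdaPrime {n : ℕ} (hn : 1 ≤ n) (B : GL (Fin n) ℝ) :
    n * lambdaForms B ^ (2 / (n : ℝ)) ≤ lambdaPrime B := by
  obtain ⟨x₀, hx₀⟩ := exists_intVec_ne_zero hn
  refine le_csInf ⟨_, 1, ⟨one_mem_diagGL n, one_mem_detPmOne n⟩, rfl⟩ ?_
  rintro _ ⟨D, ⟨hD, hD1⟩, rfl⟩
  simp only [latticeMin_columnLattice]
  refine le_csInf ⟨_, x₀, hx₀, rfl⟩ ?_
  rintro _ ⟨x, hx, rfl⟩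
  refine le_trans ?_ (card_mul_abs_prod_rpow_le_sum_sq hn _)
  have h : |∏ i, intMulVec (D * B).1 x i| = |∏ i, intMulVec B.1 x i| := by
    rw [mem_detPmOne_iff, eq_diagonal_of_mem_diagGL hD, Matrix.det_diagonal] at hD1
    rw [Units.val_mul, eq_diagonal_of_mem_diagGL hD]
    simp only [intMulVec_diagonal_mul]
    rw [Finset.prod_mul_distrib, abs_mul, hD1, one_mul]
  rw [h]
  gcongr
  · exact lambdaForms_nonneg B
  · exact lambdaForms_le B hx

/-- The function `t ↦ c t^p` commutes with infima of nonempty sets of nonnegative reals. -/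
lemma sInf_image_const_mul_rpow {S : Set ℝ} (hS : S.Nonempty) (h0 : ∀ s ∈ S, 0 ≤ s) {c p : ℝ}
    (hc : 0 ≤ c) (hp : 0 ≤ p) :
    sInf ((fun t => c * t ^ p) '' S) = c * sInf S ^ p := by
  symm
  refine MonotoneOn.map_csInf_of_continuousWithinAt (f := fun t : ℝ => c * t ^ p) ?_ ?_ hS
    ⟨0, h0⟩
  · exact (continuous_const.mul
      (Real.continuous_rpow_const hp)).continuousWithinAt
  · intro a ha b hb hab
    have := h0 a ha
    dsimp only
    gcongr

theorem lambdaPrime_eq {n : ℕ} (hn : 1 ≤ n) (B : GL (Fin n) ℝ) :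
    lambdaPrime B = n * lambdaForms B ^ (2 / (n : ℝ)) := by
  obtain ⟨x₀, hx₀⟩ := exists_intVec_ne_zero hn
  refine le_antisymm ?_ (le_lambdaPrime hn B)
  have hne : ((fun x : Fin n → ℤ => |∏ i, ∑ j, B.1 i j * (x j : ℝ)|) '' {x | x ≠ 0}).Nonempty :=
    ⟨_, x₀, hx₀, rfl⟩
  rw [lambdaForms, ← sInf_image_const_mul_rpow hne _ (Nat.cast_nonneg n) (by positivity)]
  · refine le_csInf ⟨_, _, ⟨x₀, hx₀, rfl⟩, rfl⟩ ?_
    rintro _ ⟨_, ⟨x, hx, rfl⟩, rfl⟩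
    exact lambdaPrime_le_card_mul_abs_prod hn B hx
  · rintro _ ⟨x, _, rfl⟩
    exact abs_nonneg _

/-! ### Reduction theory: bounded bases of lattices without short vectors -/

/-- Converts a lower bound on `λ(B)` into a lower bound on the sup norm of nonzero lattice vectors.
-/
lemma abs_prod_le_norm_pow {n : ℕ} (y : Fin n → ℝ) : |∏ i, y i| ≤ ‖y‖ ^ n := by
  rw [Finset.abs_prod]
  calc ∏ i, |y i| ≤ ∏ _i : Fin n, ‖y‖ :=
        Finset.prod_le_prod (fun i _ => abs_nonneg _) fun i _ => norm_le_pi_norm y i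
    _ = ‖y‖ ^ n := by simp

lemma det_smul_one_add_vecMulVec {n : ℕ} (hn : 1 ≤ n) {a : ℝ} (ha : a ≠ 0) (v w : Fin n → ℝ) :
    (a • (1 : Matrix (Fin n) (Fin n) ℝ) + vecMulVec v w).det = a ^ (n - 1) * (a + w ⬝ᵥ v) := by
  have h : a • (1 : Matrix (Fin n) (Fin n) ℝ) + vecMulVec v w
      = a • (1 + replicateCol Unit (a⁻¹ • v) * replicateRow Unit w) := by
    rw [smul_add, ← vecMulVec_eq, smul_vecMulVec, smul_smul, mul_inv_cancel₀ ha, one_smul]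
  rw [h, Matrix.det_smul, Matrix.det_one_add_replicateCol_mul_replicateRow]
  obtain ⟨m, rfl⟩ : ∃ m, n = m + 1 := ⟨n - 1, by omega⟩
  simp only [Fintype.card_fin, dotProduct_smul, smul_eq_mul, Nat.add_sub_cancel, pow_succ]
  field_simp

/-- If the lattice `Bℤⁿ` has no short vectors, its vectors of bounded length avoid
every hyperplane. -/
lemma exists_intMulVec_norm_le {n : ℕ} (hn : 1 ≤ n) {δ : ℝ} (hδ : 0 < δ)
    {B : Matrix (Fin n) (Fin n) ℝ} (hB : |B.det| = 1)
    (hmin : ∀ x : Fin n → ℤ, x ≠ 0 → δ ≤ ‖intMulVec B x‖) {u : Fin n → ℝ} (hu : u ≠ 0) :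
    ∃ x : Fin n → ℤ, u ⬝ᵥ intMulVec B x ≠ 0 ∧
      ‖intMulVec B x‖ ≤ δ + (δ ^ (n - 1))⁻¹ * n := by
  have : Nonempty (Fin n) := ⟨⟨0, hn⟩⟩
  -- Dividing `u` by its largest entry gives `|wᵢ| ≤ 1` and `w i₀ = 1`.
  obtain ⟨i₀, hi₀⟩ := Finite.exists_max fun i => |u i|
  have hui : u i₀ ≠ 0 := by
    intro h
    refine hu (funext fun i => ?_)
    have := hi₀ i
    rw [h, abs_zero] at this
    exact abs_nonpos_iff.1 this
  -- Chosen so that `det T = δ^(n-1) (δ + b) = δ^n + 1`, just above the Minkowski threshold.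
  set b := (δ ^ (n - 1))⁻¹ with hb
  have hb0 : 0 < b := by positivity
  set w : Fin n → ℝ := (u i₀)⁻¹ • u with hw
  set v : Fin n → ℝ := Pi.single i₀ b with hv
  have hwle : ∀ i, |w i| ≤ 1 := fun i => by
    rw [hw, Pi.smul_apply, smul_eq_mul, abs_mul, abs_inv, inv_mul_le_iff₀ (abs_pos.2 hui), mul_one]
    exact hi₀ i
  have hwv : w ⬝ᵥ v = b := by simp [hv, hw, hui]
  -- `T` contracts the hyperplane orthogonal to `u` by `δ` and stretches the cube along `e_{i₀}`. A
  -- lattice vector in the image of the open unit cube cannot lie in that hyperplane, since it would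
  -- be shorter than `δ`.
  set T := δ • (1 : Matrix (Fin n) (Fin n) ℝ) + vecMulVec v w with hT
  have hTdet : T.det = δ ^ n + 1 := by
    rw [hT, det_smul_one_add_vecMulVec hn hδ.ne', hwv, mul_add, hb,
      mul_inv_cancel₀ (by positivity), pow_sub_one_mul (by omega)]
  have hTpos : 1 < T.det := by rw [hTdet]; linarith [pow_pos hδ n]
  have hTunit : IsUnit T.det := isUnit_iff_ne_zero.2 (by linarith)
  have hBdet : B.det ≠ 0 := fun h => by simp [h] at hB
  obtain ⟨x, hx, hlt⟩ := exists_norm_intMulVec_lt_one (M := T⁻¹ * B)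
    (by rw [Matrix.det_mul, Matrix.det_nonsing_inv, Ring.inverse_eq_inv']
        exact mul_ne_zero (inv_ne_zero hTunit.ne_zero) hBdet)
    (by rw [Matrix.det_mul, Matrix.det_nonsing_inv, Ring.inverse_eq_inv', abs_mul, hB, mul_one,
          abs_inv, abs_of_pos (by linarith)]
        exact inv_lt_one_of_one_lt₀ hTpos)
  rw [intMulVec_mul] at hlt
  set z := intMulVec B x with hz
  set y := T⁻¹ *ᵥ z with hy
  have hzy : z = δ • y + (w ⬝ᵥ y) • v := by
    have : z = T *ᵥ y := by
      rw [hy, Matrix.mulVec_mulVec, Matrix.mul_nonsing_inv _ hTunit, Matrix.one_mulVec]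
    rw [this, hT, Matrix.add_mulVec, Matrix.smul_mulVec, Matrix.one_mulVec,
      Matrix.vecMulVec_mulVec]
    simp
  have hwz : w ⬝ᵥ z = (δ + b) * (w ⬝ᵥ y) := by
    rw [hzy, dotProduct_add, dotProduct_smul, dotProduct_smul, hwv, smul_eq_mul, smul_eq_mul]
    ring
  refine ⟨x, fun h0 => ?_, ?_⟩
  · have h1 : w ⬝ᵥ z = 0 := by rw [hw, smul_dotProduct, h0, smul_zero]
    have h2 : w ⬝ᵥ y = 0 := by
      rw [hwz] at h1
      exact (mul_eq_zero.1 h1).resolve_left (by positivity)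
    have h3 := hmin x hx
    rw [← hz, hzy, h2, zero_smul, add_zero, norm_smul, Real.norm_of_nonneg hδ.le] at h3
    nlinarith
  · have hwy : |w ⬝ᵥ y| ≤ n := by
      calc |w ⬝ᵥ y| ≤ ∑ i, |w i * y i| := Finset.abs_sum_le_sum_abs _ _
        _ ≤ ∑ _i : Fin n, (1 : ℝ) := by
          refine Finset.sum_le_sum fun i _ => ?_
          rw [abs_mul]
          exact mul_le_one₀ (hwle i) (abs_nonneg _) ((norm_le_pi_norm y i).trans hlt.le)
        _ = n := by simp
    have hvn : ‖v‖ = b := by rw [hv, Pi.norm_single, Real.norm_of_nonneg hb0.le]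
    calc ‖z‖ ≤ ‖δ • y‖ + ‖(w ⬝ᵥ y) • v‖ := by rw [hzy]; exact norm_add_le _ _
      _ ≤ δ * 1 + n * b := by
        rw [norm_smul, norm_smul, Real.norm_of_nonneg hδ.le, hvn, Real.norm_eq_abs]
        gcongr
      _ = δ + b * n := by ring

/-- A lattice without short vectors contains `n` independent vectors of bounded length. -/
lemma exists_intMatrix_norm_le {n : ℕ} (hn : 1 ≤ n) {δ : ℝ} (hδ : 0 < δ)
    {B : Matrix (Fin n) (Fin n) ℝ} (hB : |B.det| = 1)
    (hmin : ∀ x : Fin n → ℤ, x ≠ 0 → δ ≤ ‖intMulVec B x‖) :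
    ∃ C : Matrix (Fin n) (Fin n) ℤ, C.det ≠ 0 ∧
      ∀ i j, |(B * C.map (Int.cast : ℤ → ℝ)) i j| ≤ δ + (δ ^ (n - 1))⁻¹ * n := by
  set R := δ + (δ ^ (n - 1))⁻¹ * n with hR
  set S : Set (Fin n → ℝ) := {z | ∃ x : Fin n → ℤ, intMulVec B x = z ∧ ‖z‖ ≤ R} with hS
  have hspan : Submodule.span ℝ S = ⊤ := by
    -- Otherwise the bounded vectors lie in the kernel of a nonzero functional `u ⬝ᵥ ·`, which the
    -- previous lemma excludes.
    by_contra hne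
    obtain ⟨f, hf0, hf⟩ := Submodule.exists_le_ker_of_lt_top _ (lt_top_iff_ne_top.2 hne)
    set u : Fin n → ℝ := fun i => f (Pi.single i 1) with hu
    have hfu : ∀ z, f z = u ⬝ᵥ z := by
      intro z
      conv_lhs => rw [pi_eq_sum_univ' z]
      simp [hu, dotProduct, mul_comm]
    have hu0 : u ≠ 0 := by
      intro h
      refine hf0 (LinearMap.ext fun z => ?_)
      rw [hfu, h, zero_dotProduct, LinearMap.zero_apply]
    obtain ⟨x, hx, hxR⟩ := exists_intMulVec_norm_le hn hδ hB hmin hu0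
    refine hx ?_
    rw [← hfu]
    exact hf (Submodule.subset_span ⟨x, rfl, hxR⟩)
  have hfin := Submodule.exists_fun_fin_finrank_span_eq ℝ S
  rw [hspan, finrank_top, Module.finrank_fin_fun] at hfin
  obtain ⟨g, hgS, -, hg⟩ := hfin
  choose x hx hxR using hgS
  set C : Matrix (Fin n) (Fin n) ℤ := Matrix.of fun i j => x j i with hC
  have hentry : ∀ i j, (B * C.map (Int.cast : ℤ → ℝ)) i j = g j i := fun i j => by
    rw [← hx j, intMulVec_apply, Matrix.mul_apply]
    rfl
  have hdet : (B * C.map (Int.cast : ℤ → ℝ)).det ≠ 0 := by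
    have hcol : (B * C.map (Int.cast : ℤ → ℝ)).col = g := by
      ext j i
      exact hentry i j
    rw [← isUnit_iff_ne_zero, ← Matrix.isUnit_iff_isUnit_det,
      ← Matrix.linearIndependent_cols_iff_isUnit, hcol]
    exact hg
  refine ⟨C, fun h0 => hdet ?_, fun i j => ?_⟩
  · rw [Matrix.det_mul, ← Int.cast_det, h0, Int.cast_zero, mul_zero]
  · rw [hentry]
    exact (norm_le_pi_norm (g j) i).trans (hxR j)

/-- Integer matrices congruent modulo a multiple of the determinant of the second one differ by
an integral left factor. -/
lemma exists_mul_eq_of_map_eq {n N : ℕ} {C C₀ : Matrix (Fin n) (Fin n) ℤ}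
    (hdvd : C₀.det ∣ N)
    (h : C.map (Int.cast : ℤ → ZMod N) = C₀.map (Int.cast : ℤ → ZMod N)) :
    ∃ U : Matrix (Fin n) (Fin n) ℤ, U * C₀ = C := by
  have hE : ∀ i j, ∃ e : ℤ, C i j - C₀ i j = N * e := fun i j =>
    (ZMod.intCast_eq_intCast_iff_dvd_sub _ _ _).1 (congrFun (congrFun h i) j).symm
  choose E hE using hE
  obtain ⟨m, hm⟩ := hdvd
  -- Here `C = C₀ + N E` and `N = det C₀ * m`, so `N • 1 = m • adj(C₀) * C₀`.
  refine ⟨1 + Matrix.of E * (m • C₀.adjugate), ?_⟩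
  rw [add_mul, one_mul, mul_assoc, Matrix.smul_mul, Matrix.adjugate_mul, smul_smul,
    Matrix.mul_smul, Matrix.mul_one, mul_comm m, ← hm]
  ext i j
  rw [Matrix.add_apply, Matrix.smul_apply, Matrix.of_apply, smul_eq_mul, ← hE]
  ring

/-- Reduction of lattices of determinant one without short vectors: they have bases
of uniformly bounded size. -/
lemma exists_isUnit_mul_bounded {n : ℕ} (hn : 1 ≤ n) {δ : ℝ} (hδ : 0 < δ) :
    ∃ R : ℝ, ∀ B : Matrix (Fin n) (Fin n) ℝ, |B.det| = 1 →
      (∀ x : Fin n → ℤ, x ≠ 0 → δ ≤ ‖intMulVec B x‖) →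
      ∃ U : Matrix (Fin n) (Fin n) ℤ, IsUnit U ∧
        ∀ i j, |(B * U.map (Int.cast : ℤ → ℝ)) i j| ≤ R := by
  set R := δ + (δ ^ (n - 1))⁻¹ * n with hR
  have hR0 : 0 < R := by positivity
  -- The Leibniz bound gives `|det C| ≤ n! R^n`, so every determinant that can occur divides this
  -- factorial.
  set N := Nat.factorial ⌊(Nat.factorial n : ℝ) * R ^ n⌋₊ with hN
  have : NeZero N := ⟨Nat.factorial_ne_zero _⟩
  -- One representative per residue class mod `N`, with `0` as dummy value for classes containing no
  -- admissible matrix. There are finitely many classes, so the inverses of the representatives are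
  -- uniformly bounded.
  have hrep : ∀ r : Matrix (Fin n) (Fin n) (ZMod N), ∃ C₀ : Matrix (Fin n) (Fin n) ℤ,
      ∀ C : Matrix (Fin n) (Fin n) ℤ, C.det ≠ 0 → C.det ∣ N →
        C.map (Int.cast : ℤ → ZMod N) = r →
        C₀.det ≠ 0 ∧ C₀.det ∣ N ∧ C₀.map (Int.cast : ℤ → ZMod N) = r := by
    intro r
    by_cases h : ∃ C : Matrix (Fin n) (Fin n) ℤ, C.det ≠ 0 ∧ C.det ∣ N ∧
        C.map (Int.cast : ℤ → ZMod N) = r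
    · obtain ⟨C₀, h0⟩ := h
      exact ⟨C₀, fun _ _ _ _ => h0⟩
    · exact ⟨0, fun C h1 h2 h3 => (h ⟨C, h1, h2, h3⟩).elim⟩
  choose rep hrep using hrep
  obtain ⟨K, hK⟩ := (Set.finite_range fun r : Matrix (Fin n) (Fin n) (ZMod N) =>
    ∑ j, ∑ k, |((rep r).map (Int.cast : ℤ → ℝ))⁻¹ k j|).bddAbove
  refine ⟨R * K, fun B hB hmin => ?_⟩
  obtain ⟨C, hC0, hCR⟩ := exists_intMatrix_norm_le hn hδ hB hmin
  have hCdvd : C.det ∣ N := by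
    have h1 : |((C.det : ℤ) : ℝ)| ≤ (Nat.factorial n : ℝ) * R ^ n := by
      have := Matrix.det_le (abv := AbsoluteValue.abs) (A := B * C.map (Int.cast : ℤ → ℝ)) hCR
      rw [Matrix.det_mul, ← Int.cast_det] at this
      simpa [abs_mul, hB] using this
    have h2 : C.det.natAbs ≤ ⌊(Nat.factorial n : ℝ) * R ^ n⌋₊ := by
      refine Nat.le_floor ?_
      rwa [Nat.cast_natAbs, Int.cast_abs]
    have h3 := Nat.dvd_factorial (Int.natAbs_pos.2 hC0) h2
    exact Int.natAbs_dvd.1 (Int.natCast_dvd_natCast.2 h3)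
  set r := C.map (Int.cast : ℤ → ZMod N) with hr
  obtain ⟨h0, hdvd, hmap⟩ := hrep r C hC0 hCdvd rfl
  set C₀ := rep r with hC₀
  -- Divisibility holds for both matrices, so each is an integral left multiple of the other;
  -- comparing determinants makes `U` unimodular.
  obtain ⟨U, hU⟩ := exists_mul_eq_of_map_eq hdvd (hr.symm.trans hmap.symm)
  obtain ⟨W, hW⟩ := exists_mul_eq_of_map_eq hCdvd (hmap.trans hr)
  have hUunit : IsUnit U := by
    rw [Matrix.isUnit_iff_isUnit_det]
    have h1 : U.det * W.det * C.det = C.det := by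
      rw [← Matrix.det_mul, ← Matrix.det_mul, mul_assoc, hW, hU]
    exact IsUnit.of_mul_eq_one _ (mul_right_cancel₀ hC0 (h1.trans (one_mul _).symm))
  refine ⟨U, hUunit, fun i j => ?_⟩
  have hBU : B * U.map (Int.cast : ℤ → ℝ)
      = B * C.map (Int.cast : ℤ → ℝ) * (C₀.map (Int.cast : ℤ → ℝ))⁻¹ := by
    have hdet : IsUnit (C₀.map (Int.cast : ℤ → ℝ)).det := by
      rw [← Int.cast_det, isUnit_iff_ne_zero]
      exact_mod_cast h0
    have hUC : C.map (Int.cast : ℤ → ℝ)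
        = U.map (Int.cast : ℤ → ℝ) * C₀.map (Int.cast : ℤ → ℝ) := by
      rw [← hU]
      exact Matrix.map_mul (f := Int.castRingHom ℝ)
    rw [hUC, ← mul_assoc, Matrix.mul_nonsing_inv_cancel_right _ _ hdet]
  rw [hBU, Matrix.mul_apply]
  calc |∑ k, (B * C.map (Int.cast : ℤ → ℝ)) i k * (C₀.map (Int.cast : ℤ → ℝ))⁻¹ k j|
      ≤ ∑ k, R * |(C₀.map (Int.cast : ℤ → ℝ))⁻¹ k j| := by
        refine (Finset.abs_sum_le_sum_abs _ _).trans (Finset.sum_le_sum fun k _ => ?_)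
        rw [abs_mul]
        exact mul_le_mul_of_nonneg_right (hCR i k) (abs_nonneg _)
    _ = R * ∑ k, |(C₀.map (Int.cast : ℤ → ℝ))⁻¹ k j| := by rw [Finset.mul_sum]
    _ ≤ R * ∑ j, ∑ k, |(C₀.map (Int.cast : ℤ → ℝ))⁻¹ k j| := by
        refine mul_le_mul_of_nonneg_left ?_ hR0.le
        exact Finset.single_le_sum
          (f := fun j => ∑ k, |(C₀.map (Int.cast : ℤ → ℝ))⁻¹ k j|)
          (fun j _ => Finset.sum_nonneg fun k _ => abs_nonneg _) (Finset.mem_univ j)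
    _ ≤ R * K := by
        gcongr
        exact hK ⟨r, rfl⟩

lemma isUnit_mulVec_ne_zero {n : ℕ} {U : Matrix (Fin n) (Fin n) ℤ} (hU : IsUnit U)
    {x : Fin n → ℤ} (hx : x ≠ 0) : U.mulVec x ≠ 0 := fun h =>
  hx (Matrix.mulVec_injective_of_isUnit hU (h.trans (Matrix.mulVec_zero U).symm))

/-! ### Compactness and attainment of `λ_n` -/

/-- `λ` depends only on the lattice. -/
lemma lambdaForms_eq_of_mul_isUnit {n : ℕ} {B B' : GL (Fin n) ℝ}
    {U : Matrix (Fin n) (Fin n) ℤ} (hU : IsUnit U)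
    (h : B'.1 = B.1 * U.map (Int.cast : ℤ → ℝ)) : lambdaForms B' = lambdaForms B := by
  rw [lambdaForms_eq, lambdaForms_eq]
  congr 1
  ext t
  constructor
  · rintro ⟨x, hx, rfl⟩
    exact ⟨U.mulVec x, isUnit_mulVec_ne_zero hU hx, by simp only [h, intMulVec_mul_map]⟩
  · rintro ⟨x, hx, rfl⟩
    have hdet := (Matrix.isUnit_iff_isUnit_det U).1 hU
    refine ⟨U⁻¹.mulVec x, isUnit_mulVec_ne_zero ?_ hx, ?_⟩
    · exact (Matrix.isUnit_nonsing_inv_iff).2 hU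
    · simp only [h, intMulVec_mul_map, Matrix.mulVec_mulVec, Matrix.mul_nonsing_inv _ hdet,
        Matrix.one_mulVec]

/-- `λ` on matrices, as an upper semicontinuous function. -/
lemma upperSemicontinuous_iInf_abs_prod (n : ℕ) :
    UpperSemicontinuous fun M : Matrix (Fin n) (Fin n) ℝ =>
      ⨅ x : {x : Fin n → ℤ // x ≠ 0}, |∏ i, intMulVec M x.1 i| := by
  refine upperSemicontinuous_ciInf (fun M => ⟨0, ?_⟩) fun x => Continuous.upperSemicontinuous ?_
  · rintro _ ⟨x, rfl⟩
    exact abs_nonneg _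
  · simp only [intMulVec_apply]
    fun_prop

lemma lambdaForms_eq_iInf {n : ℕ} (B : GL (Fin n) ℝ) :
    lambdaForms B = ⨅ x : {x : Fin n → ℤ // x ≠ 0}, |∏ i, intMulVec B.1 x.1 i| := by
  rw [lambdaForms_eq, sInf_image']
  rfl

lemma isCompact_bounded_det_eq_one (n : ℕ) (R : ℝ) :
    IsCompact {M : Matrix (Fin n) (Fin n) ℝ | (∀ i j, |M i j| ≤ R) ∧ |M.det| = 1} := by
  have h1 : IsCompact {M : Matrix (Fin n) (Fin n) ℝ | ∀ i j, |M i j| ≤ R} := by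
    have h : IsCompact (Set.univ.pi fun _ : Fin n => Set.univ.pi fun _ : Fin n => Set.Icc (-R) R) :=
      isCompact_univ_pi fun _ => isCompact_univ_pi fun _ => isCompact_Icc
    refine h.of_isClosed_subset ?_ fun M hM i _ j _ => abs_le.1 (hM i j)
    simp only [Set.ofPred_forall]
    exact isClosed_iInter fun i => isClosed_iInter fun j =>
      isClosed_le (by fun_prop) continuous_const
  exact h1.inter_right (isClosed_eq (by fun_prop) continuous_const)

/-- The supremum `λ_n` is attained. -/
theorem exists_isMaxOn_lambdaForms {n : ℕ} (hn : 1 ≤ n) :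
    ∃ B₀ ∈ detPmOne n, ∀ B ∈ detPmOne n, lambdaForms B ≤ lambdaForms B₀ := by
  -- If `λ` vanishes throughout, any matrix is a maximiser. Otherwise only matrices with `λ ≥ c > 0`
  -- compete, and these can be reduced into a compact set.
  by_cases hpos : ∃ B₁ ∈ detPmOne n, 0 < lambdaForms B₁
  swap
  · push Not at hpos
    exact ⟨1, one_mem_detPmOne n, fun B hB => (hpos B hB).trans (lambdaForms_nonneg _)⟩
  obtain ⟨B₁, hB₁, hc⟩ := hpos
  set c := lambdaForms B₁ with hcdef
  set δ := c ^ (n : ℝ)⁻¹ with hδdef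
  have hδ : 0 < δ := Real.rpow_pos_of_pos hc _
  have hδn : δ ^ n = c := Real.rpow_inv_natCast_pow hc.le (by omega)
  obtain ⟨R, hR⟩ := exists_isUnit_mul_bounded hn hδ
  set S := {M : Matrix (Fin n) (Fin n) ℝ | (∀ i j, |M i j| ≤ R) ∧ |M.det| = 1} with hS
  have hred : ∀ B ∈ detPmOne n, c ≤ lambdaForms B →
      ∃ B' : GL (Fin n) ℝ, B'.1 ∈ S ∧ lambdaForms B' = lambdaForms B := by
    intro B hB hcB
    rw [mem_detPmOne_iff] at hB
    obtain ⟨U, hU, hUR⟩ := hR B.1 hB fun x hx => by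
      refine le_of_pow_le_pow_left₀ (n := n) (by omega) (norm_nonneg _) ?_
      rw [hδn]
      exact hcB.trans ((lambdaForms_le B hx).trans (abs_prod_le_norm_pow _))
    have hdet : |(B.1 * U.map (Int.cast : ℤ → ℝ)).det| = 1 := by
      rw [Matrix.det_mul, abs_mul, hB, one_mul, ← Int.cast_det]
      rcases Int.isUnit_iff.1 ((Matrix.isUnit_iff_isUnit_det U).1 hU) with h | h <;> simp [h]
    exact ⟨Matrix.GeneralLinearGroup.mkOfDetNeZero (B.1 * U.map (Int.cast : ℤ → ℝ))
      fun h0 => by simp [h0] at hdet, ⟨hUR, hdet⟩, lambdaForms_eq_of_mul_isUnit hU rfl⟩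
  obtain ⟨B₁', hB₁', -⟩ := hred B₁ hB₁ le_rfl
  obtain ⟨M, hMS, hMmax⟩ := UpperSemicontinuousOn.exists_isMaxOn ⟨_, hB₁'⟩
    (isCompact_bounded_det_eq_one n R)
    ((upperSemicontinuous_iInf_abs_prod n).upperSemicontinuousOn S)
  have hM0 : M.det ≠ 0 := fun h0 => by simpa [h0] using hMS.2
  set B₀ := Matrix.GeneralLinearGroup.mkOfDetNeZero M hM0 with hB₀
  have hmax : ∀ B ∈ detPmOne n, c ≤ lambdaForms B → lambdaForms B ≤ lambdaForms B₀ := by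
    intro B hB hcB
    obtain ⟨B', hB'S, hB'⟩ := hred B hB hcB
    rw [← hB', lambdaForms_eq_iInf, lambdaForms_eq_iInf]
    exact hMmax hB'S
  refine ⟨B₀, (mem_detPmOne_iff _).2 hMS.2, fun B hB => ?_⟩
  rcases le_total c (lambdaForms B) with h | h
  · exact hmax B hB h
  · exact h.trans (hmax B₁ hB₁ le_rfl)

/-! ### Packing density and homothety -/

lemma toReal_volume_ball_one {n : ℕ} (hn : 1 ≤ n) :
    (volume (Metric.ball (0 : EuclideanSpace ℝ (Fin n)) 1)).toReal
      = Real.pi ^ ((n : ℝ) / 2) / Real.Gamma ((n : ℝ) / 2 + 1) := by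
  have : Nonempty (Fin n) := ⟨⟨0, hn⟩⟩
  rw [EuclideanSpace.volume_ball, Fintype.card_fin, ENNReal.ofReal_one, one_pow, one_mul,
    ENNReal.toReal_ofReal]
  · rw [Real.sqrt_eq_rpow, ← Real.rpow_natCast, ← Real.rpow_mul Real.pi_pos.le]
    ring_nf
  · have := Real.Gamma_pos_of_pos (s := (n : ℝ) / 2 + 1) (by positivity)
    positivity

lemma exists_eq_smul_of_det {n : ℕ} (hn : 1 ≤ n) (B : GL (Fin n) ℝ) :
    ∃ r : ℝ, 0 < r ∧ ∃ B₁ ∈ detPmOne n, B.1 = r • B₁.1 := by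
  have hB := abs_pos.2 (GL_det_ne_zero B)
  set r := |B.1.det| ^ (n : ℝ)⁻¹ with hr
  have hr0 : 0 < r := Real.rpow_pos_of_pos hB _
  have hrn : r ^ n = |B.1.det| := Real.rpow_inv_natCast_pow hB.le (by omega)
  have hdet : |(r⁻¹ • B.1).det| = 1 := by
    rw [Matrix.det_smul, Fintype.card_fin, abs_mul, ← hrn, abs_of_pos (by positivity), inv_pow,
      inv_mul_cancel₀ (by positivity)]
  refine ⟨r, hr0, Matrix.GeneralLinearGroup.mkOfDetNeZero (r⁻¹ • B.1)
    (fun h0 => by simp [h0] at hdet), (mem_detPmOne_iff _).2 hdet, ?_⟩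
  change B.1 = r • r⁻¹ • B.1
  rw [smul_smul, mul_inv_cancel₀ hr0.ne', one_smul]

lemma latticeMin_columnLattice_smul {n : ℕ} {B B₁ : GL (Fin n) ℝ} {r : ℝ}
    (h : B.1 = r • B₁.1) :
    latticeMin (columnLattice B) = r ^ 2 * latticeMin (columnLattice B₁) := by
  rw [latticeMin_columnLattice, latticeMin_columnLattice, ← smul_eq_mul,
    ← Real.sInf_smul_of_nonneg (sq_nonneg r), ← Set.image_smul, Set.image_image]
  congr 2
  ext x
  rw [smul_eq_mul, Finset.mul_sum]
  refine Finset.sum_congr rfl fun i _ => ?_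
  rw [h, intMulVec, Matrix.smul_mulVec, Pi.smul_apply, smul_eq_mul, mul_pow]
  rfl

/-- The packing density of a lattice of determinant one with squared minimal length `m`. -/
noncomputable def densityOfMin (n : ℕ) (m : ℝ) : ℝ :=
  (volume (Metric.ball (0 : EuclideanSpace ℝ (Fin n)) 1)).toReal / 2 ^ n * m ^ ((n : ℝ) / 2)

lemma densityOfMin_mono {n : ℕ} {a b : ℝ} (ha : 0 ≤ a) (hab : a ≤ b) :
    densityOfMin n a ≤ densityOfMin n b := by
  unfold densityOfMin
  gcongr

lemma packingDensity_columnLattice_smul {n : ℕ} {B B₁ : GL (Fin n) ℝ} {r : ℝ} (hr : 0 < r)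
    (h : B.1 = r • B₁.1) (h₁ : B₁ ∈ detPmOne n) :
    packingDensity (columnLattice B) = densityOfMin n (latticeMin (columnLattice B₁)) := by
  rw [mem_detPmOne_iff] at h₁
  have hrn : (r ^ 2) ^ ((n : ℝ) / 2) = r ^ n := by
    rw [← Real.rpow_natCast, ← Real.rpow_mul hr.le, ← Real.rpow_natCast]
    congr 1
    push_cast
    ring
  rw [packingDensity, densityOfMin, covolume_columnLattice, latticeMin_columnLattice_smul h, h,
    Matrix.det_smul, abs_mul, h₁, mul_one, Fintype.card_fin, abs_of_pos (pow_pos hr n),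
    Real.mul_rpow (sq_nonneg r) (latticeMin_nonneg _), hrn]
  field_simp

/-- Every invertible diagonal matrix is a positive multiple of one with determinant `±1`, and
homotheties do not affect the density. The remaining infimum passes through `m ↦ c m^(n/2)`, which
is monotone and continuous. -/
lemma densityInf_eq {n : ℕ} (hn : 1 ≤ n) {B B₁ : GL (Fin n) ℝ} {r : ℝ} (hr : 0 < r)
    (h : B.1 = r • B₁.1) (h₁ : B₁ ∈ detPmOne n) :
    densityInf B = densityOfMin n (lambdaPrime B₁) := by
  have hne : ((fun D => latticeMin (columnLattice (D * B₁))) ''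
      (diagGL n ∩ detPmOne n)).Nonempty :=
    ⟨_, 1, ⟨one_mem_diagGL n, one_mem_detPmOne n⟩, rfl⟩
  rw [densityInf, lambdaPrime, densityOfMin, ← sInf_image_const_mul_rpow hne _ (by positivity)
    (by positivity), Set.image_image]
  swap
  · rintro _ ⟨D, _, rfl⟩
    exact latticeMin_nonneg _
  have hmul : ∀ D D₁ : GL (Fin n) ℝ, ∀ s : ℝ, 0 < s → D.1 = s • D₁.1 → D₁ ∈ detPmOne n →
      packingDensity (columnLattice (D * B))
        = densityOfMin n (latticeMin (columnLattice (D₁ * B₁))) := by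
    intro D D₁ s hs hD hD₁
    refine packingDensity_columnLattice_smul (mul_pos hs hr) ?_ ?_
    · rw [Units.val_mul, Units.val_mul, hD, h, Matrix.smul_mul, Matrix.mul_smul, smul_smul]
    · rw [mem_detPmOne_iff] at *
      rw [Units.val_mul, Matrix.det_mul, abs_mul, hD₁, h₁, one_mul]
  congr 1
  ext t
  constructor
  · rintro ⟨D, hD, rfl⟩
    obtain ⟨s, hs, D₁, hD₁, hDs⟩ := exists_eq_smul_of_det hn D
    refine ⟨D₁, ⟨?_, hD₁⟩, (hmul D D₁ s hs hDs hD₁).symm⟩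
    have : D₁.1 = s⁻¹ • D.1 := by rw [hDs, smul_smul, inv_mul_cancel₀ hs.ne', one_smul]
    change D₁.1.IsDiag
    rw [this]
    exact Matrix.IsDiag.smul _ hD
  · rintro ⟨D, ⟨hD, hD₁⟩, rfl⟩
    exact ⟨D, hD, hmul D D 1 one_pos (one_smul _ _).symm hD₁⟩

/-! ### The lower bound from totally real fields -/

section TotallyReal

open NumberField

variable (K : Type*) [Field K] [NumberField K] [IsTotallyReal K]

lemma ofReal_re_algHom_apply (φ : K →ₐ[ℚ] ℂ) (x : K) : (((φ x).re : ℝ) : ℂ) = φ x := by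
  have h := IsTotallyReal.complexEmbedding_isReal (φ : K →+* ℂ)
  rw [← Complex.conj_eq_iff_re]
  exact RingHom.congr_fun h x

/-- The matrix of real embeddings of an integral basis of a totally real field. -/
lemma exists_matrix_det_sq_eq_discr {n : ℕ} (hK : Module.finrank ℚ K = n) :
    ∃ M : Matrix (Fin n) (Fin n) ℝ, M.det ^ 2 = discr K ∧
      ∀ x : Fin n → ℤ, x ≠ 0 → 1 ≤ |∏ i, intMulVec M x i| := by
  have hcard : Fintype.card (Module.Free.ChooseBasisIndex ℤ (𝓞 K)) = Fintype.card (Fin n) := by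
    rw [← Module.finrank_eq_card_chooseBasisIndex, RingOfIntegers.rank, hK, Fintype.card_fin]
  have e := Fintype.equivOfCardEq hcard
  have hcard' : Fintype.card (Fin n) = Fintype.card (K →ₐ[ℚ] ℂ) := by
    rw [AlgHom.card, hK, Fintype.card_fin]
  have f := Fintype.equivOfCardEq hcard'
  set ω := (RingOfIntegers.basis K).reindex e with hω
  set b : Fin n → K := fun j => (ω j : K) with hb
  set M : Matrix (Fin n) (Fin n) ℝ := Matrix.of fun i j => (f i (b j)).re with hM
  -- Real parts lose nothing because all embeddings are real. The transpose appears because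
  -- `Algebra.embeddingsMatrix` indexes its rows by the basis.
  have hMap : (M.map Complex.ofReal)ᵀ = Algebra.embeddingsMatrixReindex ℚ ℂ b f := by
    ext i j
    simp [hM, Algebra.embeddingsMatrixReindex, Algebra.embeddingsMatrix, ofReal_re_algHom_apply]
  refine ⟨M, ?_, fun x hx => ?_⟩
  · have h1 := Algebra.discr_eq_det_embeddingsMatrixReindex_pow_two ℚ ℂ b f
    have h2 : Algebra.discr ℚ b = (discr K : ℚ) := by
      have h3 : b = (integralBasis K) ∘ e.symm := by
        ext j
        simp [hb, hω]
      rw [h3, Algebra.discr_reindex, coe_discr]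
    have h3 : (Complex.ofReal M.det) ^ 2 = ((discr K : ℝ) : ℂ) := by
      rw [← hMap, Matrix.det_transpose, h2] at h1
      have : (M.map Complex.ofReal).det = Complex.ofReal M.det :=
        (RingHom.map_det Complex.ofRealHom M).symm
      rw [← this, ← h1]
      simp
    exact_mod_cast h3
  · set α : 𝓞 K := ∑ j, x j • ω j with hα
    have hα0 : α ≠ 0 := fun h0 => hx (funext
      (Fintype.linearIndependent_iff.1 ω.linearIndependent x h0))
    have hval : ∀ i, (intMulVec M x i : ℂ) = f i (α : K) := by
      intro i
      rw [← ofReal_re_algHom_apply, hα, intMulVec_apply]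
      congr 1
      simp [hM, hb, mul_comm]
    have hprod : (((∏ i, intMulVec M x i : ℝ)) : ℂ) = ((Algebra.norm ℤ α : ℤ) : ℂ) := by
      have h1 := Algebra.norm_eq_prod_embeddings ℚ ℂ (α : K)
      rw [← Algebra.coe_norm_int, ← f.prod_comp] at h1
      push_cast
      rw [Finset.prod_congr rfl fun i _ => hval i, ← h1]
      simp
    have hprod' : (∏ i, intMulVec M x i : ℝ) = ((Algebra.norm ℤ α : ℤ) : ℝ) := by
      exact_mod_cast hprod
    rw [hprod', ← Int.cast_abs]
    exact_mod_cast Int.one_le_abs (Algebra.norm_ne_zero_iff.2 hα0)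

/-- Normalising the embedding matrix to determinant `±1` divides each product of forms, at least `1`
in absolute value, by `|det M| = d_K^(1/2)`. -/
lemma exists_discr_rpow_le_lambdaForms {n : ℕ} (hn : 1 ≤ n) (hK : Module.finrank ℚ K = n) :
    ∃ B ∈ detPmOne n, (discr K : ℝ) ^ (-(1 / 2) : ℝ) ≤ lambdaForms B := by
  obtain ⟨M, hdet, hprod⟩ := exists_matrix_det_sq_eq_discr K hK
  have hM0 : M.det ≠ 0 := by
    intro h
    rw [h, zero_pow two_ne_zero] at hdet
    exact discr_ne_zero K (by exact_mod_cast hdet.symm)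
  set A := Matrix.GeneralLinearGroup.mkOfDetNeZero M hM0 with hA
  obtain ⟨r, hr, B, hB, hAB⟩ := exists_eq_smul_of_det hn A
  refine ⟨B, hB, ?_⟩
  have hdet' : |M.det| = r ^ n := by
    have : M.det = r ^ n * B.1.det := by
      change A.1.det = _
      rw [hAB, Matrix.det_smul, Fintype.card_fin]
    rw [this, abs_mul, (mem_detPmOne_iff B).1 hB, mul_one, abs_of_pos (pow_pos hr n)]
  have hd : (discr K : ℝ) ^ (-(1 / 2) : ℝ) = (r ^ n)⁻¹ := by
    rw [← hdet, ← sq_abs, hdet', ← Real.rpow_natCast, ← Real.rpow_mul (by positivity)]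
    norm_num
    rw [Real.rpow_neg_one]
  obtain ⟨x₀, hx₀⟩ := exists_intVec_ne_zero hn
  rw [hd]
  refine le_csInf ⟨_, x₀, hx₀, rfl⟩ ?_
  rintro _ ⟨x, hx, rfl⟩
  have h1 := hprod x hx
  have h2 : ∏ i, intMulVec M x i = r ^ n * ∏ i, intMulVec B.1 x i := by
    have : ∀ i, intMulVec M x i = r * intMulVec B.1 x i := fun i => by
      change intMulVec A.1 x i = _
      rw [hAB, intMulVec, Matrix.smul_mulVec]
      rfl
    simp [this, Finset.prod_mul_distrib]
  rw [h2, abs_mul, abs_of_pos (pow_pos hr n)] at h1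
  rw [inv_le_iff_one_le_mul₀' (pow_pos hr n)]
  exact h1

end TotallyReal

/-! ### Assembly: one maximiser for all three suprema -/

theorem lemma1 (n : ℕ) (hn : 1 ≤ n) :
    -- (1)
    (∀ B : GL (Fin n) ℝ, lambdaForms B ≠ 0 →
      lambdaPrime B = n * lambdaForms B ^ (2 / (n : ℝ))) ∧
    -- the suprema `λ_n` and `λ'_n` are finite
    IsLUB (lambdaForms '' detPmOne n) (lambdaFormsSup n) ∧
    IsLUB (lambdaPrime '' detPmOne n) (lambdaPrimeSup n) ∧
    -- (2) the bound from a totally real field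
    (∀ (K : Type u) [Field K] [NumberField K] [NumberField.IsTotallyReal K],
      Module.finrank ℚ K = n →
        lambdaFormsSup n ≥ (NumberField.discr K : ℝ) ^ (-(1 / 2) : ℝ)) ∧
    -- the supremum `Δ'_n` is finite and attained
    IsGreatest (Set.range fun B : GL (Fin n) ℝ => densityInf B) (densitySup n) ∧
    -- its value, and the resulting lower bound
    densitySup n =
      (Real.pi * lambdaPrimeSup n / 4) ^ ((n : ℝ) / 2) / Real.Gamma ((n : ℝ) / 2 + 1) ∧
    (Real.pi * lambdaPrimeSup n / 4) ^ ((n : ℝ) / 2) / Real.Gamma ((n : ℝ) / 2 + 1) =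
      (Real.pi * n / 4) ^ ((n : ℝ) / 2) * lambdaFormsSup n / Real.Gamma ((n : ℝ) / 2 + 1) ∧
    (∀ (K : Type u) [Field K] [NumberField K] [NumberField.IsTotallyReal K],
      Module.finrank ℚ K = n →
        (Real.pi * n / 4) ^ ((n : ℝ) / 2) * lambdaFormsSup n / Real.Gamma ((n : ℝ) / 2 + 1) ≥
          (Real.pi * n / 4) ^ ((n : ℝ) / 2) * (NumberField.discr K : ℝ) ^ (-(1 / 2) : ℝ)
            / Real.Gamma ((n : ℝ) / 2 + 1)) := by
  have hn0 : (0 : ℝ) < n := by exact_mod_cast hn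
  obtain ⟨B₀, hB₀, hmax⟩ := exists_isMaxOn_lambdaForms hn
  have hforms : IsGreatest (lambdaForms '' detPmOne n) (lambdaForms B₀) :=
    ⟨⟨B₀, hB₀, rfl⟩, by rintro _ ⟨B, hB, rfl⟩; exact hmax B hB⟩
  have hmax' : ∀ B ∈ detPmOne n, lambdaPrime B ≤ lambdaPrime B₀ := fun B hB => by
    have h0 := lambdaForms_nonneg B
    have h1 := hmax B hB
    rw [lambdaPrime_eq hn, lambdaPrime_eq hn]
    gcongr
  have hprime : IsGreatest (lambdaPrime '' detPmOne n) (lambdaPrime B₀) :=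
    ⟨⟨B₀, hB₀, rfl⟩, by rintro _ ⟨B, hB, rfl⟩; exact hmax' B hB⟩
  have hdens₀ : densityInf B₀ = densityOfMin n (lambdaPrime B₀) :=
    densityInf_eq hn one_pos (one_smul _ _).symm hB₀
  have hdens : IsGreatest (Set.range fun B : GL (Fin n) ℝ => densityInf B) (densityInf B₀) := by
    refine ⟨⟨B₀, rfl⟩, ?_⟩
    rintro _ ⟨B, rfl⟩
    obtain ⟨r, hr, B₁, hB₁, h⟩ := exists_eq_smul_of_det hn B
    simp only [hdens₀, densityInf_eq hn hr h hB₁]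
    exact densityOfMin_mono (lambdaPrime_nonneg _) (hmax' B₁ hB₁)
  have hformsSup : lambdaFormsSup n = lambdaForms B₀ := hforms.csSup_eq
  have hprimeSup : lambdaPrimeSup n = lambdaPrime B₀ := hprime.csSup_eq
  have hdensSup : densitySup n = densityInf B₀ := hdens.csSup_eq
  have hfield : ∀ (K : Type u) [Field K] [NumberField K] [NumberField.IsTotallyReal K],
      Module.finrank ℚ K = n →
        lambdaFormsSup n ≥ (NumberField.discr K : ℝ) ^ (-(1 / 2) : ℝ) := by
    intro K _ _ _ hK
    obtain ⟨B, hB, hle⟩ := exists_discr_rpow_le_lambdaForms K hn hK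
    rw [hformsSup]
    exact hle.trans (hmax B hB)
  have hΓ : 0 < Real.Gamma ((n : ℝ) / 2 + 1) := Real.Gamma_pos_of_pos (by positivity)
  refine ⟨fun B _ => lambdaPrime_eq hn B, hformsSup ▸ hforms.isLUB, hprimeSup ▸ hprime.isLUB,
    hfield, hdensSup ▸ hdens, ?_, ?_, fun K _ _ _ hK => ?_⟩
  · rw [hdensSup, hdens₀, hprimeSup, densityOfMin, toReal_volume_ball_one hn, mul_div_assoc,
      Real.mul_rpow Real.pi_pos.le (div_nonneg (lambdaPrime_nonneg _) (by norm_num)),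
      Real.div_rpow (lambdaPrime_nonneg _) (by norm_num)]
    -- The factor `4^(n/2)` is the `2^n` of the packing density.
    have h4 : (4 : ℝ) ^ ((n : ℝ) / 2) = 2 ^ n := by
      rw [show (4 : ℝ) = 2 ^ (2 : ℝ) by norm_num, ← Real.rpow_mul (by norm_num),
        ← Real.rpow_natCast]
      congr 1
      ring
    rw [h4]
    field_simp
  · rw [hprimeSup, hformsSup, lambdaPrime_eq hn]
    congr 1
    have h0 := lambdaForms_nonneg B₀
    rw [show Real.pi * (n * lambdaForms B₀ ^ (2 / (n : ℝ))) / 4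
        = Real.pi * n / 4 * lambdaForms B₀ ^ (2 / (n : ℝ)) by ring,
      Real.mul_rpow (by positivity) (by positivity), ← Real.rpow_mul h0]
    have : 2 / (n : ℝ) * (n / 2) = 1 := by field_simp
    rw [this, Real.rpow_one]
  · have := hfield K hK
    gcongr
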